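/- All graphs are finite and simple. A graph is perfect if, for each of its induced subgraphs, the chromatic number equals the maximum size of a clique. A linear system $Ax\le b$ with rational data is totally dual integral (TDI) if $\min\{b^\top y : A^\top y=w,\ y\ge \mathbf 0\}$ has an integer optimal solution for every integer vector $w$ for which this minimum is finite, and box-TDI if the system $Ax\le b,\ \ell\le x\le u$ is TDI for all rational vectors $\ell,u$. A graph $G=(V,E)$ is box-perfect if the system $x(C)\le 1$ for all cliques $C$ of $G$, $x\ge \mathbf 0$ (with $x\in\mathbb{R}^V$ and $x(C)=\sum_{i\in C}x_i$) is box-TDI. Let $v\in V$ and let $X,Y\subseteq V$ be such that $X\cup Y=N_G(v)$ and no edge of $G$ connects $X\setminus Y$ and $Y\setminus X$. Unfolding $v$ (with respect to $X$ and $Y$) means deleting $v$, adding new vertices $x$ and $y$ whose neighborhoods among the remaining vertices of $G$ are respectively $X$ and $Y$, and adding another new vertex $z$ adjacent to exactly $x$ and $y$. **Lemma.** Let $G$ be a graph that is perfect but not box-perfect. Then, for every vertex $v$ of $G$ and all such $X$ and $Y$, the graph obtained from $G$ by unfolding $v$ with respect to $X$ and $Y$ is not box-perfect. -/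

import Mathlib

/-- `y` is feasible for the dual program `min {bᵀy : Aᵀy = w, y ≥ 0}` of `max {wᵀx : Ax ≤ b}`. -/
def DualFeasible {ι κ : Type*} [Fintype ι] (A : Matrix ι κ ℚ) (w : κ → ℤ) (y : ι → ℝ) : Prop :=
  (∀ i, 0 ≤ y i) ∧ ∀ j, ∑ i, (A i j : ℝ) * y i = (w j : ℝ)

/-- `y` is an optimal solution of `min {bᵀy : Aᵀy = w, y ≥ 0}`. -/
def DualOptimal {ι κ : Type*} [Fintype ι] (A : Matrix ι κ ℚ) (b : ι → ℚ) (w : κ → ℤ)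
    (y : ι → ℝ) : Prop :=
  DualFeasible A w y ∧
    ∀ y' : ι → ℝ, DualFeasible A w y' → ∑ i, (b i : ℝ) * y i ≤ ∑ i, (b i : ℝ) * y' i

/-- The system `Ax ≤ b` is totally dual integral: for every integer vector `w` for which
`min {bᵀy : Aᵀy = w, y ≥ 0}` is finite (for a linear program: attained), the minimum is attained
by an integer vector. -/
def IsTDI {ι κ : Type*} [Fintype ι] (A : Matrix ι κ ℚ) (b : ι → ℚ) : Prop :=
  ∀ w : κ → ℤ, (∃ y : ι → ℝ, DualOptimal A b w y) →
    ∃ z : ι → ℤ, DualOptimal A b w (fun i => (z i : ℝ))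

/-- The constraint matrix of the system `Ax ≤ b, x ≤ u, -x ≤ -l`. -/
def boxMatrix {ι κ : Type*} [DecidableEq κ] (A : Matrix ι κ ℚ) : Matrix (ι ⊕ (κ ⊕ κ)) κ ℚ :=
  Matrix.fromRows A (Matrix.fromRows 1 (-1))

/-- The right-hand side of the system `Ax ≤ b, x ≤ u, -x ≤ -l`. -/
def boxRhs {ι κ : Type*} (b : ι → ℚ) (l u : κ → ℚ) : ι ⊕ (κ ⊕ κ) → ℚ :=
  Sum.elim b (Sum.elim u (-l))

/-- The system `Ax ≤ b` is box-TDI: the system `Ax ≤ b, l ≤ x ≤ u` is TDI for all rational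
vectors `l` and `u`. -/
def IsBoxTDI {ι κ : Type*} [Fintype ι] [Fintype κ] [DecidableEq κ]
    (A : Matrix ι κ ℚ) (b : ι → ℚ) : Prop :=
  ∀ l u : κ → ℚ, IsTDI (boxMatrix A) (boxRhs b l u)

namespace SimpleGraph

/-- A graph is perfect if the chromatic number of each induced subgraph equals the largest size
of a clique of that subgraph. -/
def IsPerfect {V : Type*} (G : SimpleGraph V) : Prop :=
  ∀ S : Set V, (G.induce S).chromaticNumber = ((G.induce S).cliqueNum : ℕ∞)

/-- The type of cliques of a graph. -/
abbrev CliqueType {V : Type*} (G : SimpleGraph V) : Type _ :=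
  {C : Finset V // G.IsClique (C : Set V)}

/-- The constraint matrix of the system `x(C) ≤ 1` for all cliques `C`, `-x ≤ 0`. -/
def cliqueSystemMatrix {V : Type*} [DecidableEq V] (G : SimpleGraph V) :
    Matrix (G.CliqueType ⊕ V) V ℚ :=
  Matrix.fromRows (Matrix.of fun C j => if j ∈ C.1 then 1 else 0) (-1)

/-- The right-hand side of the system `x(C) ≤ 1` for all cliques `C`, `-x ≤ 0`. -/
def cliqueSystemRhs {V : Type*} (G : SimpleGraph V) : G.CliqueType ⊕ V → ℚ :=
  Sum.elim (fun _ => 1) (fun _ => 0)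

open Classical in
/-- A graph is box-perfect if the system consisting of the clique inequalities and the
nonnegativity constraints is box-TDI. -/
def IsBoxPerfect {V : Type*} [Fintype V] (G : SimpleGraph V) : Prop :=
  IsBoxTDI G.cliqueSystemMatrix G.cliqueSystemRhs

/-- The three vertices created by unfolding a vertex. -/
inductive UnfoldNew : Type
  | x
  | y
  | z

instance : Fintype UnfoldNew :=
  ⟨⟨[UnfoldNew.x, UnfoldNew.y, UnfoldNew.z], by simp⟩, by intro a; cases a <;> simp⟩

/-- The adjacency relation of the graph obtained from `G` by deleting `v` and adding vertices
`x`, `y`, `z`, where `x` is adjacent to `X` and `z`, `y` is adjacent to `Y` and `z`, and `z` is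
adjacent to `x` and `y` only. -/
def UnfoldAdj {V : Type*} (G : SimpleGraph V) (v : V) (X Y : Set V) :
    {a : V // a ≠ v} ⊕ UnfoldNew → {a : V // a ≠ v} ⊕ UnfoldNew → Prop
  | .inl a, .inl b => G.Adj a b
  | .inl a, .inr .x => (a : V) ∈ X
  | .inr .x, .inl a => (a : V) ∈ X
  | .inl a, .inr .y => (a : V) ∈ Y
  | .inr .y, .inl a => (a : V) ∈ Y
  | .inr .x, .inr .z => True
  | .inr .z, .inr .x => True
  | .inr .y, .inr .z => True
  | .inr .z, .inr .y => True
  | _, _ => False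

/-- The graph obtained from `G` by unfolding `v` with respect to the sets `X` and `Y`. -/
def unfold {V : Type*} (G : SimpleGraph V) (v : V) (X Y : Set V) :
    SimpleGraph ({a : V // a ≠ v} ⊕ UnfoldNew) where
  Adj := G.UnfoldAdj v X Y
  symm := ⟨by
    rintro (a | _ | _ | _) (b | _ | _ | _) h <;> simp_all [UnfoldAdj, G.adj_comm]⟩
  loopless := ⟨by
    rintro (a | _ | _ | _) h <;> simp_all [UnfoldAdj]⟩

end SimpleGraph

/-! ### Transfer of total dual integrality between linear systems. -/

section Transfer

variable {ι ι' : Type*} [Fintype ι] [Fintype ι']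

/-! On the slice `x + z = y + z = 1` of the unfolded system, a single coordinate `x_v = x = y = 1 -
z` survives, and the system becomes that of `G` up to trivial or repeated rows. A large integer
weight `M` forces this slice: weights `w v + M`, `M`, `2 * M` on `x`, `y`, `z` amount there to `w v`
on `x_v` plus the constant `2 * M`. Dually, merging rows with equal image projects solutions and
lowers the cost by exactly `2 * M`; conversely, a solution for `G` lifts, with leftover weight on
the cliques `{x, z}` and `{y, z}`. Hence optima correspond, and an integral optimum for the
unfolding projects to one for `G` (`IsTDI.of_unfold_rows`). The graph theory is the matching of
rows: `CliqueType.exists_row_of_unfold` projects cliques, `CliqueType.exists_row_unfold` lifts them.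
-/

theorem sum_mul_partialPushforward [DecidableEq ι] (g : ι' → Option ι) (c : ι → ℝ) (y : ι' → ℝ) :
    ∑ i, c i * (∑ i', if g i' = some i then y i' else 0) =
      ∑ i', (g i').elim 0 c * y i' := by
  simp_rw [Finset.mul_sum]
  rw [Finset.sum_comm]
  refine Finset.sum_congr rfl fun i' _ => ?_
  cases hgi : g i' with
  | none => simp
  | some k => simp

theorem sum_mul_pushforward_add [DecidableEq ι'] (h : ι → ι') (p q : ι') (α β : ℝ) (c : ι' → ℝ)
    (y : ι → ℝ) :
    ∑ i', c i' * ((∑ i, if h i = i' then y i else 0) + (if i' = p then α else 0) +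
        (if i' = q then β else 0)) =
      ∑ i, c (h i) * y i + c p * α + c q * β := by
  simp_rw [mul_add, Finset.sum_add_distrib, Finset.mul_sum]
  rw [Finset.sum_comm]
  simp

open SimpleGraph in
/-- Total dual integrality passes from a system in the coordinates of an unfolding to a system in
the original coordinates, when every row of the first one becomes a row of the second one (or
vanishes) under the substitution sending `x_v` to `x`, `y` and `1 - z`, and every row of the
second one lifts to a row of the first one that does not involve `z`. -/
theorem IsTDI.of_unfold_rows {V : Type*} {v : V} {A : Matrix ι V ℚ} {b : ι → ℚ}
    {A' : Matrix ι' ({a : V // a ≠ v} ⊕ UnfoldNew) ℚ} {b' : ι' → ℚ} (H : IsTDI A' b')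
    (hproj : ∀ i', ∃ o : Option ι,
      (∀ a : {a : V // a ≠ v}, o.elim 0 (fun i => A i a) = A' i' (.inl a)) ∧
      o.elim 0 (fun i => A i v) = A' i' (.inr .x) + A' i' (.inr .y) - A' i' (.inr .z) ∧
      o.elim 0 b = b' i' - A' i' (.inr .z))
    (hlift : ∀ i, ∃ i', (∀ a : {a : V // a ≠ v}, A' i' (.inl a) = A i a) ∧
      A' i' (.inr .x) + A' i' (.inr .y) = A i v ∧ A' i' (.inr .z) = 0 ∧ b' i' = b i)
    (p q : ι') (hp : ∀ a, A' p (.inl a) = 0) (hpx : A' p (.inr .x) = 1)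
    (hpy : A' p (.inr .y) = 0) (hpz : A' p (.inr .z) = 1) (hpb : b' p = 1)
    (hq : ∀ a, A' q (.inl a) = 0) (hqx : A' q (.inr .x) = 0)
    (hqy : A' q (.inr .y) = 1) (hqz : A' q (.inr .z) = 1) (hqb : b' q = 1) :
    IsTDI A b := by
  classical
  choose g hg hgv hgb using hproj
  choose h hh hhv hhz hhb using hlift
  rintro w ⟨y, ⟨hy0, hyw⟩, hyopt⟩
  set sx : ℝ := ∑ i, (A' (h i) (.inr .x) : ℝ) * y i with hsx
  set sy : ℝ := ∑ i, (A' (h i) (.inr .y) : ℝ) * y i with hsy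
  have hsxy : sx + sy = w v := by
    rw [hsx, hsy, ← hyw v, ← Finset.sum_add_distrib]
    refine Finset.sum_congr rfl fun i _ => ?_
    rw [← hhv i]; push_cast; ring
  -- `M` is an integer, so that `w'` is integral, and large enough that the multipliers added at `p`
  -- and `q` below are nonnegative.
  obtain ⟨M, hM⟩ := exists_nat_ge (max (sx - w v) sy)
  have hM₁ : sx - w v ≤ M := (le_max_left _ _).trans hM
  have hM₂ : sy ≤ M := (le_max_right _ _).trans hM
  let w' : {a : V // a ≠ v} ⊕ UnfoldNew → ℤ := fun
    | .inl a => w a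
    | .inr .x => w v + M
    | .inr .y => M
    | .inr .z => 2 * M
  -- Add up the multipliers of all rows with the same image, dropping rows that vanish.
  let φ : (ι' → ℝ) → ι → ℝ := fun t i => ∑ i', if g i' = some i then t i' else 0
  have helim : ∀ (i' : ι') (c : ι → ℚ),
      (g i').elim (0 : ℝ) (fun i => (c i : ℝ)) = (((g i').elim 0 c : ℚ) : ℝ) := by
    intro i' c
    cases g i' <;> simp
  have hφ : ∀ t, DualFeasible A' w' t → DualFeasible A w (φ t) ∧
      ∑ i, (b i : ℝ) * φ t i = ∑ i', (b' i' : ℝ) * t i' - 2 * M := by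
    rintro t ⟨ht0, htw⟩
    refine ⟨⟨fun i => Finset.sum_nonneg fun i' _ => ?_, fun j => ?_⟩, ?_⟩
    · split_ifs
      exacts [ht0 i', le_rfl]
    · simp only [φ]
      rw [sum_mul_partialPushforward g (fun i => (A i j : ℝ)) t]
      simp_rw [helim _ fun i => A i j]
      by_cases hj : j = v
      · subst hj
        have e₁ := htw (.inr .x)
        have e₂ := htw (.inr .y)
        have e₃ := htw (.inr .z)
        simp only [w'] at e₁ e₂ e₃
        push_cast at e₁ e₂ e₃
        simp_rw [hgv]
        push_cast
        simp_rw [sub_mul, add_mul, Finset.sum_sub_distrib, Finset.sum_add_distrib]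
        rw [e₁, e₂, e₃]
        ring
      · simp_rw [hg _ ⟨j, hj⟩]
        exact htw (.inl ⟨j, hj⟩)
    · simp only [φ]
      rw [sum_mul_partialPushforward g (fun i => (b i : ℝ)) t]
      have e₃ := htw (.inr .z)
      simp only [w'] at e₃
      push_cast at e₃
      simp_rw [helim _ b, hgb]
      push_cast
      simp_rw [sub_mul, Finset.sum_sub_distrib]
      rw [e₃]
  -- The lifted rows leave deficits `M + w v - sx` at `x` and `M - sy` at `y`. Rows `p` and `q` fill
  -- them; since `sx + sy = w v`, they contribute exactly `2 * M` at `z`.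
  let y' : ι' → ℝ := fun i' => (∑ i, if h i = i' then y i else 0) +
    (if i' = p then M + w v - sx else 0) + (if i' = q then M - sy else 0)
  have hy'sum : ∀ c : ι' → ℝ, ∑ i', c i' * y' i' =
      ∑ i, c (h i) * y i + c p * (M + w v - sx) + c q * (M - sy) :=
    fun c => sum_mul_pushforward_add h p q _ _ c y
  have hy'feas : DualFeasible A' w' y' := by
    refine ⟨fun i' => ?_, ?_⟩
    · have : 0 ≤ ∑ i, if h i = i' then y i else 0 :=
        Finset.sum_nonneg fun i _ => by
          split_ifs
          exacts [hy0 i, le_rfl]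
      simp only [y']
      split_ifs <;> linarith
    · rintro (a | _ | _ | _) <;> rw [hy'sum fun i' => (A' i' _ : ℝ)]
      · simp only [hh, hp, hq, w', hyw]
        simp
      · simp only [hpx, hqx, w', ← hsx]
        push_cast; ring
      · simp only [hpy, hqy, w', ← hsy]
        push_cast; ring
      · simp only [hpz, hqz, hhz, w']
        push_cast
        simp only [zero_mul, Finset.sum_const_zero]
        linarith
  have hy'cost : ∑ i', (b' i' : ℝ) * y' i' = ∑ i, (b i : ℝ) * y i + 2 * M := by
    rw [hy'sum fun i' => (b' i' : ℝ)]
    simp only [hhb, hpb, hqb]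
    push_cast
    linarith
  -- `y'` is optimal: a cheaper `t` would project under `φ` to a solution cheaper than `y`.
  obtain ⟨z, hz, hzopt⟩ := H w' ⟨y', hy'feas, fun t ht => by
    obtain ⟨h₁, h₂⟩ := hφ t ht
    linarith [hyopt _ h₁]⟩
  obtain ⟨hzf, hzc⟩ := hφ _ hz
  have hint : (fun i => ((∑ i', if g i' = some i then z i' else 0 : ℤ) : ℝ)) =
      φ fun i' => (z i' : ℝ) := by
    funext i
    simp only [φ]
    push_cast
    rfl
  refine ⟨fun i => ∑ i', if g i' = some i then z i' else 0, ?_⟩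
  rw [hint]
  refine ⟨hzf, fun t ht => ?_⟩
  linarith [hyopt t ht, hzopt _ hy'feas]

end Transfer

/-! ### Cliques of a graph and of its unfolding. -/

namespace SimpleGraph

variable {V : Type*} {G : SimpleGraph V} {v : V} {X Y : Set V}

/-- The map from the vertices of an unfolding of `v` that sends each new vertex to `v`. -/
def unfoldProj (v : V) : {a : V // a ≠ v} ⊕ UnfoldNew → V
  | .inl a => a
  | .inr _ => v

/-- The extension of a function on the original vertices to those of an unfolding of `v` by given
values at the new vertices. -/
def unfoldExtend {α : Type*} (v : V) (f : V → α) (p q r : α) :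
    {a : V // a ≠ v} ⊕ UnfoldNew → α
  | .inl a => f a
  | .inr .x => p
  | .inr .y => q
  | .inr .z => r

open Classical in
/-- The embedding of the original vertices into those of an unfolding of `v` that sends `v` to a
given new vertex. -/
noncomputable def unfoldLift (v : V) (n : UnfoldNew) (a : V) : {a : V // a ≠ v} ⊕ UnfoldNew :=
  if h : a = v then .inr n else .inl ⟨a, h⟩

@[simp] theorem unfoldLift_self (n : UnfoldNew) : unfoldLift v n v = .inr n := by
  simp [unfoldLift]

theorem unfoldLift_of_ne (n : UnfoldNew) {a : V} (h : a ≠ v) :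
    unfoldLift v n a = .inl ⟨a, h⟩ := by
  simp [unfoldLift, h]

theorem unfoldLift_eq_inl {n : UnfoldNew} {a : V} {c : {a : V // a ≠ v}} :
    unfoldLift v n a = .inl c ↔ a = c := by
  by_cases h : a = v
  · subst h
    simpa using c.2.symm
  · rw [unfoldLift_of_ne n h, Sum.inl.injEq, Subtype.ext_iff]

theorem unfoldLift_eq_inr {n m : UnfoldNew} {a : V} :
    unfoldLift v n a = .inr m ↔ a = v ∧ n = m := by
  by_cases h : a = v
  · simp [h]
  · simp [unfoldLift_of_ne n h, h]

/-- A clique of an unfolding avoiding `z` projects to a clique. -/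
theorem IsClique.image_unfoldProj (hXY : X ∪ Y = G.neighborSet v)
    {C : Set ({a : V // a ≠ v} ⊕ UnfoldNew)} (hC : (G.unfold v X Y).IsClique C)
    (hz : .inr .z ∉ C) : G.IsClique (unfoldProj v '' C) := by
  have hX : ∀ a ∈ X, G.Adj v a := fun a ha => by
    rw [← mem_neighborSet, ← hXY]; exact .inl ha
  have hY : ∀ a ∈ Y, G.Adj v a := fun a ha => by
    rw [← mem_neighborSet, ← hXY]; exact .inr ha
  rintro _ ⟨s, hs, rfl⟩ _ ⟨t, ht, rfl⟩ hne
  have hst : G.UnfoldAdj v X Y s t := hC hs ht fun h => hne (by rw [h])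
  rcases s with a | _ | _ | _ <;> rcases t with c | _ | _ | _ <;>
    first
    | exact absurd rfl hne
    | exact absurd hs hz
    | exact absurd ht hz
    | exact hst
    | exact hX _ hst
    | exact hY _ hst
    | exact (hX _ hst).symm
    | exact (hY _ hst).symm

theorem isClique_image_unfoldLift_x {C : Set V} (hC : G.IsClique C)
    (hCX : v ∈ C → C \ {v} ⊆ X) : (G.unfold v X Y).IsClique (unfoldLift v .x '' C) := by
  rintro _ ⟨a, ha, rfl⟩ _ ⟨c, hc, rfl⟩ hne
  have hac : a ≠ c := fun h => hne (by rw [h])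
  change G.UnfoldAdj v X Y _ _
  by_cases hav : a = v
  · subst hav
    rw [unfoldLift_self, unfoldLift_of_ne _ hac.symm]
    exact hCX ha ⟨hc, hac.symm⟩
  · by_cases hcv : c = v
    · subst hcv
      rw [unfoldLift_self, unfoldLift_of_ne _ hac]
      exact hCX hc ⟨ha, hac⟩
    · rw [unfoldLift_of_ne _ hav, unfoldLift_of_ne _ hcv]
      exact hC ha hc hac

theorem isClique_image_unfoldLift_y {C : Set V} (hC : G.IsClique C)
    (hCY : v ∈ C → C \ {v} ⊆ Y) : (G.unfold v X Y).IsClique (unfoldLift v .y '' C) := by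
  rintro _ ⟨a, ha, rfl⟩ _ ⟨c, hc, rfl⟩ hne
  have hac : a ≠ c := fun h => hne (by rw [h])
  change G.UnfoldAdj v X Y _ _
  by_cases hav : a = v
  · subst hav
    rw [unfoldLift_self, unfoldLift_of_ne _ hac.symm]
    exact hCY ha ⟨hc, hac.symm⟩
  · by_cases hcv : c = v
    · subst hcv
      rw [unfoldLift_self, unfoldLift_of_ne _ hac]
      exact hCY hc ⟨ha, hac⟩
    · rw [unfoldLift_of_ne _ hav, unfoldLift_of_ne _ hcv]
      exact hC ha hc hac

/-- Every clique lifts to a clique of an unfolding, with `v` lifted to `x` or to `y`. -/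
theorem IsClique.exists_isClique_image_unfoldLift (hXY : X ∪ Y = G.neighborSet v)
    (hsep : ∀ a ∈ X \ Y, ∀ b ∈ Y \ X, ¬ G.Adj a b) {C : Set V} (hC : G.IsClique C) :
    ∃ n : UnfoldNew, (n = .x ∨ n = .y) ∧ (G.unfold v X Y).IsClique (unfoldLift v n '' C) := by
  by_cases hX : v ∈ C → C \ {v} ⊆ X
  · exact ⟨.x, .inl rfl, isClique_image_unfoldLift_x hC hX⟩
  · push Not at hX
    obtain ⟨hv, hX⟩ := hX
    obtain ⟨a, ⟨ha, hav⟩, haX⟩ := Set.not_subset.mp hX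
    have hN : ∀ c ∈ C, c ≠ v → c ∈ X ∪ Y := fun c hc hcv => by
      rw [hXY]; exact hC hv hc hcv.symm
    have haY : a ∈ Y := (hN a ha hav).resolve_left haX
    -- A vertex `c` of the clique outside `Y` would lie in `X \ Y` and be adjacent to `a ∈ Y \ X`.
    refine ⟨.y, .inr rfl, isClique_image_unfoldLift_y hC fun _ c ⟨hc, hcv⟩ => ?_⟩
    by_contra hcY
    have hcX : c ∈ X := (hN c hc hcv).resolve_right hcY
    exact hsep c ⟨hcX, hcY⟩ a ⟨haY, haX⟩ (hC hc ha fun h => haX (h ▸ hcX))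

theorem CliqueType.exists_row_of_unfold [DecidableEq V]
    [DecidableEq ({a : V // a ≠ v} ⊕ UnfoldNew)]
    (hXY : X ∪ Y = G.neighborSet v)
    (C : (G.unfold v X Y).CliqueType) : ∃ o : Option (G.CliqueType ⊕ V),
      (∀ a : {a : V // a ≠ v}, o.elim 0 (fun i => G.cliqueSystemMatrix i a) =
        (G.unfold v X Y).cliqueSystemMatrix (.inl C) (.inl a)) ∧
      o.elim 0 (fun i => G.cliqueSystemMatrix i v) =
        (G.unfold v X Y).cliqueSystemMatrix (.inl C) (.inr .x) +
        (G.unfold v X Y).cliqueSystemMatrix (.inl C) (.inr .y) -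
        (G.unfold v X Y).cliqueSystemMatrix (.inl C) (.inr .z) ∧
      o.elim 0 G.cliqueSystemRhs = 1 -
        (G.unfold v X Y).cliqueSystemMatrix (.inl C) (.inr .z) := by
  have hxy : .inr .x ∈ C.1 → .inr .y ∉ C.1 := fun hx hy => C.2 hx hy (by simp)
  by_cases hz : .inr .z ∈ C.1
  · have hza : ∀ a : {a : V // a ≠ v}, .inl a ∉ C.1 := fun a ha => C.2 hz ha (by simp)
    by_cases hx : .inr .x ∈ C.1 ∨ .inr .y ∈ C.1
    · refine ⟨none, fun a => ?_, ?_, ?_⟩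
      · simp [cliqueSystemMatrix, hza]
      · rcases hx with hx | hy
        · simp [cliqueSystemMatrix, hx, hxy hx, hz]
        · simp [cliqueSystemMatrix, hy, mt hxy (not_not.mpr hy), hz]
      · simp [cliqueSystemMatrix, hz]
    · push Not at hx
      refine ⟨some (.inr v), fun a => ?_, ?_, ?_⟩
      · simp [cliqueSystemMatrix, hza, a.2.symm]
      · simp [cliqueSystemMatrix, hx, hz]
      · simp [cliqueSystemMatrix, cliqueSystemRhs, hz]
  · refine ⟨some (.inl ⟨C.1.image (unfoldProj v), ?_⟩), fun a => ?_, ?_, ?_⟩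
    · rw [Finset.coe_image]
      exact C.2.image_unfoldProj hXY (by simpa using hz)
    · simp [cliqueSystemMatrix, unfoldProj, a.2.symm, a.2]
    · have : v ∈ C.1.image (unfoldProj v) ↔ .inr .x ∈ C.1 ∨ .inr .y ∈ C.1 := by
        simp only [Finset.mem_image]
        constructor
        · rintro ⟨a | _ | _ | _, hC, ha⟩
          exacts [absurd ha a.2, .inl hC, .inr hC, absurd hC hz]
        · rintro (hC | hC)
          exacts [⟨_, hC, rfl⟩, ⟨_, hC, rfl⟩]
      by_cases hx : .inr .x ∈ C.1
      · simp [cliqueSystemMatrix, -Finset.mem_image, this, hx, hxy hx, hz]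
      · simp [cliqueSystemMatrix, -Finset.mem_image, this, hx, hz]
    · simp [cliqueSystemMatrix, cliqueSystemRhs, hz]

theorem CliqueType.exists_row_unfold [DecidableEq V]
    [DecidableEq ({a : V // a ≠ v} ⊕ UnfoldNew)]
    (hXY : X ∪ Y = G.neighborSet v)
    (hsep : ∀ a ∈ X \ Y, ∀ b ∈ Y \ X, ¬ G.Adj a b) (C : G.CliqueType) :
    ∃ C' : (G.unfold v X Y).CliqueType,
      (∀ a : {a : V // a ≠ v}, (G.unfold v X Y).cliqueSystemMatrix (.inl C') (.inl a) =
        G.cliqueSystemMatrix (.inl C) a) ∧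
      (G.unfold v X Y).cliqueSystemMatrix (.inl C') (.inr .x) +
        (G.unfold v X Y).cliqueSystemMatrix (.inl C') (.inr .y) =
        G.cliqueSystemMatrix (.inl C) v ∧
      (G.unfold v X Y).cliqueSystemMatrix (.inl C') (.inr .z) = 0 := by
  obtain ⟨n, hn, hC⟩ := C.2.exists_isClique_image_unfoldLift (v := v) hXY hsep
  refine ⟨⟨C.1.image (unfoldLift v n), by rwa [Finset.coe_image]⟩, fun a => ?_, ?_, ?_⟩
  · simp [cliqueSystemMatrix, unfoldLift_eq_inl]
  · rcases hn with rfl | rfl <;> simp [cliqueSystemMatrix, unfoldLift_eq_inr]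
  · rcases hn with rfl | rfl <;> simp [cliqueSystemMatrix, unfoldLift_eq_inr]

/-! ### Matching the rows of the boxed systems. -/

set_option linter.unusedSimpArgs false in
-- Only `x` inherits the box of `v`. The bounds `0` and `1` on `y` and `z` add nothing, as they
-- become `0 ≤ x_v` or `x_v ≤ 1`, both already in the clique system.
theorem isTDI_boxMatrix_of_unfold [DecidableEq V]
    [DecidableEq ({a : V // a ≠ v} ⊕ UnfoldNew)]
    {_ : Fintype ((G.CliqueType ⊕ V) ⊕ (V ⊕ V))}
    {_ : Fintype (((G.unfold v X Y).CliqueType ⊕ ({a : V // a ≠ v} ⊕ UnfoldNew)) ⊕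
      (({a : V // a ≠ v} ⊕ UnfoldNew) ⊕ ({a : V // a ≠ v} ⊕ UnfoldNew)))}
    (hXY : X ∪ Y = G.neighborSet v)
    (hsep : ∀ a ∈ X \ Y, ∀ b ∈ Y \ X, ¬ G.Adj a b) (l u : V → ℚ)
    (H : IsTDI (boxMatrix (G.unfold v X Y).cliqueSystemMatrix)
      (boxRhs (G.unfold v X Y).cliqueSystemRhs (unfoldExtend v l (l v) 0 0)
        (unfoldExtend v u (u v) 1 1))) :
    IsTDI (boxMatrix G.cliqueSystemMatrix) (boxRhs G.cliqueSystemRhs l u) := by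
  have hv : ∀ a, v = a ↔ a = v := fun _ => eq_comm
  let cv : G.CliqueType := ⟨{v}, by simp⟩
  refine H.of_unfold_rows ?_ ?_
    (.inl (.inl ⟨{.inr .x, .inr .z}, ?_⟩)) (.inl (.inl ⟨{.inr .y, .inr .z}, ?_⟩))
    ?_ ?_ ?_ ?_ ?_ ?_ ?_ ?_ ?_ ?_
  · rintro ((C | (a | _ | _ | _)) | ((a | _ | _ | _) | (a | _ | _ | _)))
    · obtain ⟨o, h₁, h₂, h₃⟩ := CliqueType.exists_row_of_unfold hXY C
      refine ⟨o.map .inl, ?_⟩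
      cases o <;> exact ⟨h₁, h₂, h₃⟩
    · exact ⟨some (.inl (.inr a)), by simp [a.2, boxMatrix, boxRhs, cliqueSystemMatrix,
        cliqueSystemRhs, unfoldExtend, Matrix.one_apply, cv, Subtype.ext_iff, hv]⟩
    · exact ⟨some (.inl (.inr v)), by simp [boxMatrix, boxRhs, cliqueSystemMatrix,
        cliqueSystemRhs, unfoldExtend, Matrix.one_apply, cv, Subtype.ext_iff, hv]⟩
    · exact ⟨some (.inl (.inr v)), by simp [boxMatrix, boxRhs, cliqueSystemMatrix,
        cliqueSystemRhs, unfoldExtend, Matrix.one_apply, cv, Subtype.ext_iff, hv]⟩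
    -- Under `z = 1 - x_v`, the row `-z ≤ 0` reads `x_v ≤ 1`, the inequality of the clique `{v}`.
    · exact ⟨some (.inl (.inl cv)), by simp [boxMatrix, boxRhs, cliqueSystemMatrix,
        cliqueSystemRhs, unfoldExtend, Matrix.one_apply, cv, Subtype.ext_iff, hv]⟩
    · exact ⟨some (.inr (.inl a)), by simp [a.2, boxMatrix, boxRhs, cliqueSystemMatrix,
        cliqueSystemRhs, unfoldExtend, Matrix.one_apply, cv, Subtype.ext_iff, hv]⟩
    · exact ⟨some (.inr (.inl v)), by simp [boxMatrix, boxRhs, cliqueSystemMatrix,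
        cliqueSystemRhs, unfoldExtend, Matrix.one_apply, cv, Subtype.ext_iff, hv]⟩
    · exact ⟨some (.inl (.inl cv)), by simp [boxMatrix, boxRhs, cliqueSystemMatrix,
        cliqueSystemRhs, unfoldExtend, Matrix.one_apply, cv, Subtype.ext_iff, hv]⟩
    · exact ⟨some (.inl (.inr v)), by simp [boxMatrix, boxRhs, cliqueSystemMatrix,
        cliqueSystemRhs, unfoldExtend, Matrix.one_apply, cv, Subtype.ext_iff, hv]⟩
    · exact ⟨some (.inr (.inr a)), by simp [a.2, boxMatrix, boxRhs, cliqueSystemMatrix,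
        cliqueSystemRhs, unfoldExtend, Matrix.one_apply, cv, Subtype.ext_iff, hv]⟩
    · exact ⟨some (.inr (.inr v)), by simp [boxMatrix, boxRhs, cliqueSystemMatrix,
        cliqueSystemRhs, unfoldExtend, Matrix.one_apply, cv, Subtype.ext_iff, hv]⟩
    · exact ⟨some (.inl (.inr v)), by simp [boxMatrix, boxRhs, cliqueSystemMatrix,
        cliqueSystemRhs, unfoldExtend, Matrix.one_apply, cv, Subtype.ext_iff, hv]⟩
    · exact ⟨some (.inl (.inl cv)), by simp [boxMatrix, boxRhs, cliqueSystemMatrix,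
        cliqueSystemRhs, unfoldExtend, Matrix.one_apply, cv, Subtype.ext_iff, hv]⟩
  · rintro ((C | a) | (a | a))
    · obtain ⟨C', h₁, h₂, h₃⟩ := C.exists_row_unfold hXY hsep
      exact ⟨.inl (.inl C'), h₁, h₂, h₃, rfl⟩
    · refine ⟨.inl (.inr (unfoldLift v .x a)), ?_⟩
      by_cases ha : a = v
      · subst ha
        simp [boxMatrix, boxRhs, cliqueSystemMatrix, cliqueSystemRhs, Matrix.one_apply, hv]
      · simp [boxMatrix, boxRhs, cliqueSystemMatrix, cliqueSystemRhs, Matrix.one_apply,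
          unfoldLift_of_ne .x ha, ha]
    · refine ⟨.inr (.inl (unfoldLift v .x a)), ?_⟩
      by_cases ha : a = v
      · subst ha
        simp [boxMatrix, boxRhs, unfoldExtend, Matrix.one_apply, hv]
      · simp [boxMatrix, boxRhs, unfoldExtend, Matrix.one_apply,
          unfoldLift_of_ne .x ha, ha]
    · refine ⟨.inr (.inr (unfoldLift v .x a)), ?_⟩
      by_cases ha : a = v
      · subst ha
        simp [boxMatrix, boxRhs, unfoldExtend, Matrix.one_apply, hv]
      · simp [boxMatrix, boxRhs, unfoldExtend, Matrix.one_apply,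
          unfoldLift_of_ne .x ha, ha]
  · rw [Finset.coe_pair, isClique_pair]
    exact fun _ => trivial
  · rw [Finset.coe_pair, isClique_pair]
    exact fun _ => trivial
  all_goals simp [boxMatrix, boxRhs, cliqueSystemMatrix, cliqueSystemRhs]

/-- Box-perfection passes from an unfolding of a graph to the graph. -/
theorem IsBoxPerfect.of_unfold [Fintype V] [DecidableEq V] (hXY : X ∪ Y = G.neighborSet v)
    (hsep : ∀ a ∈ X \ Y, ∀ b ∈ Y \ X, ¬ G.Adj a b) (H : (G.unfold v X Y).IsBoxPerfect) :
    G.IsBoxPerfect :=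
  fun l u => @isTDI_boxMatrix_of_unfold V G v X Y
    (fun _ _ => Classical.propDecidable _) (fun _ _ => Classical.propDecidable _) _ _ hXY hsep l u
    (H _ _)

end SimpleGraph

theorem lemma5p4 {V : Type*} [Fintype V] [DecidableEq V] (G : SimpleGraph V)
    (hperf : G.IsPerfect) (hbox : ¬ G.IsBoxPerfect)
    (v : V) (X Y : Set V) (hXY : X ∪ Y = G.neighborSet v)
    (hsep : ∀ a ∈ X \ Y, ∀ b ∈ Y \ X, ¬ G.Adj a b) :
    ¬ (G.unfold v X Y).IsBoxPerfect :=
  fun H => hbox (H.of_unfold hXY hsep)
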